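/- Let $R$ be a commutative ring. Functors are covariant functors on the category of commutative $R$-algebras. Let $\mathcal R$ be the functor of rings $\mathcal R(R')=R'$. An $\mathcal R$-module is a functor of abelian groups $\mathbb M$ together with an $R'$-module structure on $\mathbb M(R')$ for every commutative $R$-algebra $R'$, compatible with the maps $\mathbb M(R')\to\mathbb M(R'')$ induced by the $R$-algebra morphisms $R'\to R''$. For an $R$-module $M$, let $\mathcal M$ be the $\mathcal R$-module $\mathcal M(R')=M\otimes_R R'$. An $\mathcal R$-module is called an $\mathcal R$-module affine scheme if its underlying functor of sets is isomorphic to the functor of points $R'\mapsto \operatorname{Hom}_{R\text{-sch}}(\operatorname{Spec} R',X)$ of an affine $R$-scheme $X$ (it is not assumed to be reflexive). An $R$-module $M$ is called a flat Mittag-Leffler module if it is the direct limit of a system $\{L_i\}_{i\in I}$ of finitely generated free $R$-modules, indexed by an upward directed set $I$, such that for each $i$ there exists $j\ge i$ with $\operatorname{Im}(L_k^*\to L_i^*)=\operatorname{Im}(L_j^*\to L_i^*)$ for all $k\ge j$, where $L^*=\operatorname{Hom}_R(L,R)$. **Theorem.** Let $M$ be an $R$-module. Then $M$ is a flat Mittag-Leffler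 module if and only if $\mathcal M$ is a direct limit of $\mathcal R$-submodule affine schemes, that is, $\mathcal M=\varinjlim_{j\in J}\mathbb N_j$ in the category of $\mathcal R$-modules, for some direct system of $\mathcal R$-module affine schemes $\{\mathbb N_j\}_{j\in J}$ indexed by an upward directed set $J$ such that every structure morphism $\mathbb N_j\to\mathcal M$ is a monomorphism. -/

import Mathlib

open CategoryTheory TensorProduct

universe u

/-- The functor of rings `𝓡` from commutative `R`-algebras to rings, `𝓡(R') = R'`.
A covariant functor on `R`-algebras is written as a presheaf on the opposite category (the category
of affine `R`-schemes), so an algebra `A` appears as `X : (CommAlgCat R)ᵒᵖᵒᵖ`, with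
`A = X.unop.unop`. -/
abbrev algebraRing (R : Type u) [CommRing R] : (CommAlgCat.{u} R)ᵒᵖᵒᵖ ⥤ RingCat.{u} :=
  unopUnop (CommAlgCat.{u} R) ⋙ forget₂ (CommAlgCat.{u} R) CommRingCat.{u} ⋙
    forget₂ CommRingCat.{u} RingCat.{u}

/-- `𝓡`-modules: functors of abelian groups `𝕄` on commutative `R`-algebras with an `R'`-module
structure on `𝕄(R')` for each `R'`, compatible with the maps `R' ⟶ R''`. -/
abbrev AlgebraModule (R : Type u) [CommRing R] := PresheafOfModules.{u} (algebraRing R)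

/-- Base change along an algebra map `φ` is `φ`-semilinear. -/
theorem rTensor_algHom_smul {R : Type u} [CommRing R] (M : Type u) [AddCommGroup M] [Module R M]
    {A B : Type u} [CommRing A] [Algebra R A] [CommRing B] [Algebra R B] (φ : A →ₐ[R] B)
    (a : A) (z : A ⊗[R] M) :
    LinearMap.rTensor M φ.toLinearMap (a • z) = φ a • LinearMap.rTensor M φ.toLinearMap z := by
  induction z using TensorProduct.induction_on with
  | zero => simp
  | add x y hx hy => rw [smul_add, map_add, map_add, smul_add, hx, hy]
  | tmul b m => simp [TensorProduct.smul_tmul']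

/-- The quasi-coherent `𝓡`-module `𝓜` of an `R`-module `M`, `𝓜(R') = R' ⊗[R] M`. -/
noncomputable def quasiCoherent (R : Type u) [CommRing R] (M : Type u) [AddCommGroup M]
    [Module R M] : AlgebraModule R where
  obj X := ModuleCat.of X.unop.unop (X.unop.unop ⊗[R] M)
  map {X Y} f := ModuleCat.ofHom
      (Y := (ModuleCat.restrictScalars ((algebraRing R).map f).hom).obj
        (ModuleCat.of Y.unop.unop (Y.unop.unop ⊗[R] M)))
    { toFun := LinearMap.rTensor M f.unop.unop.hom.toLinearMap
      map_add' := map_add _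
      map_smul' := fun a z => rTensor_algHom_smul M f.unop.unop.hom a z }
  map_id X := by
    ext z
    exact LinearMap.rTensor_id_apply M _ z
  map_comp f g := by
    ext z
    exact LinearMap.rTensor_comp_apply M g.unop.unop.hom.toLinearMap f.unop.unop.hom.toLinearMap z

/-- The functor of points `X^·(R') = Hom_{R-sch}(Spec R', X)` of an `R`-scheme `X`. -/
noncomputable def functorOfPoints {R : Type u} [CommRing R]
    (X : Over (AlgebraicGeometry.Spec (CommRingCat.of R))) :
    (CommAlgCat.{u} R)ᵒᵖᵒᵖ ⥤ Type u :=
  (AlgebraicGeometry.algSpec (CommRingCat.of R)).op ⋙ yoneda.obj X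

/-- `𝔽` is an `𝓡`-module affine scheme: its underlying functor of sets is the functor of points of
an affine `R`-scheme `X`. (By Yoneda, the `𝓡`-module structure is then the same thing as a structure
of `R`-module scheme on `X`.) -/
def IsModuleAffineScheme {R : Type u} [CommRing R] (F : AlgebraModule R) : Prop :=
  ∃ X : Over (AlgebraicGeometry.Spec (CommRingCat.of R)),
    AlgebraicGeometry.IsAffine X.left ∧
      Nonempty (functorOfPoints X ≅ F.presheaf ⋙ forget AddCommGrpCat.{u})

/-- `𝔽` is a direct limit of `𝓡`-submodule affine schemes: it is the colimit, in the category of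
`𝓡`-modules, of a direct system `N` of `𝓡`-module affine schemes indexed by an upward directed set,
such that the structure morphisms `N i ⟶ 𝔽` are monomorphisms. -/
def IsDirectLimitOfSubmoduleAffineSchemes {R : Type u} [CommRing R] (F : AlgebraModule R) : Prop :=
  ∃ (ι : Type u) (_ : Preorder ι) (_ : IsDirectedOrder ι) (_ : Nonempty ι)
    (N : ι ⥤ AlgebraModule R) (t : N ⟶ (Functor.const ι).obj F),
    (∀ i, IsModuleAffineScheme (N.obj i)) ∧ (∀ i, Mono (t.app i)) ∧
      Nonempty (Limits.IsColimit (Limits.Cocone.mk F t))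

/-- `M` is a flat Mittag-Leffler module: it is the direct limit of a system of finite free modules
`L i`, indexed by an upward directed set, such that the inverse system of duals satisfies the
Mittag-Leffler condition: for each `i` there is `j ≥ i` such that for all `k ≥ j` the images of
`(L k)* → (L i)*` and `(L j)* → (L i)*` are equal. -/
def IsFlatMittagLeffler (R : Type u) [CommRing R] (M : Type u) [AddCommGroup M]
    [Module R M] : Prop :=
  ∃ (ι : Type u) (_ : Preorder ι) (_ : IsDirectedOrder ι) (_ : Nonempty ι)
    (L : ι ⥤ ModuleCat.{u} R) (t : L ⟶ (Functor.const ι).obj (ModuleCat.of R M)),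
    (∀ i, Module.Free R (L.obj i) ∧ Module.Finite R (L.obj i)) ∧
      Nonempty (Limits.IsColimit (Limits.Cocone.mk (ModuleCat.of R M) t)) ∧
      ∀ i, ∃ (j : ι) (hij : i ≤ j), ∀ (k : ι) (hjk : j ≤ k),
        LinearMap.range (L.map (homOfLE (hij.trans hjk))).hom.dualMap =
          LinearMap.range (L.map (homOfLE hij)).hom.dualMap

/-! From affine submodules to Mittag-Leffler: points of an affine functor are algebra maps, so every
point of `𝓜` is a specialization of some `ξ = ∑ b_s ⊗ m'_s` over an algebra `B` whose maps are
determined by their effect on `ξ`. Testing this on the square-zero extension `R ⊕ Rⁿ` gives, for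
each tuple `m`, a map `f : Rⁿ → Rᵏ` over `M` killing all relations `∑ c_i ⊗ m_i = 0` in any `C ⊗ M`
(`exists_dominating`). With `C = R`, the finite free modules over `M` form a filtered category with
colimit `M`. With `C = (Rⁿ)* / im g*`, the image of `f*` lies in that of every `g*`, which is the
Mittag-Leffler condition.

Conversely, let `V_i ⊆ (L i)*` be the stable image. For `j` large `(L j)*` maps onto `V_i`, so
`Hom(V_i, A)` embeds in `Hom((L j)*, A) = A ⊗ L j` and then maps to `A ⊗ M`. These functors are
represented by `Sym V_i`, and they exhaust `𝓜`. -/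

open Opposite Limits


/-! ### Affine functors as representable functors; universal points -/

section Representable

variable {R : Type u} [CommRing R]

/-- The functor of points of `Spec B` is represented by `B`. -/
noncomputable def functorOfPointsAlgSpec (B : CommAlgCat.{u} R) :
    yoneda.obj (op B) ≅
      functorOfPoints ((AlgebraicGeometry.algSpec (CommRingCat.of R)).obj (op B)) :=
  NatIso.ofComponents
    (fun X => (AlgebraicGeometry.algSpec.fullyFaithful (R := CommRingCat.of R).homEquiv
      (X := X.unop) (Y := op B)).toIso)
    (fun {X Y} f => by
      ext g
      exact (AlgebraicGeometry.algSpec (CommRingCat.of R)).map_comp f.unop g)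

theorem isModuleAffineScheme_iff (F : AlgebraModule R) :
    IsModuleAffineScheme F ↔ ∃ B : CommAlgCat.{u} R,
      Nonempty (yoneda.obj (op B) ≅ F.presheaf ⋙ forget AddCommGrpCat.{u}) := by
  constructor
  · rintro ⟨X, hX, ⟨e⟩⟩
    obtain ⟨B, ⟨i⟩⟩ := AlgebraicGeometry.essImage_algSpec (R := CommRingCat.of R).mpr hX
    exact ⟨B.unop, ⟨functorOfPointsAlgSpec B.unop ≪≫
      Functor.isoWhiskerLeft _ (yoneda.mapIso i) ≪≫ e⟩⟩
  · rintro ⟨B, ⟨e⟩⟩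
    exact ⟨_, AlgebraicGeometry.essImage_algSpec (R := CommRingCat.of R).mp
      (Functor.obj_mem_essImage _ (op B)), ⟨(functorOfPointsAlgSpec B).symm ≪≫ e⟩⟩

/-- If `𝓜` is a direct limit of submodule affine schemes, every point of `𝓜` is a specialization
of a point `ξ` of `𝓜` over an algebra `B` on which algebra maps out of `B` are determined by their
effect. -/
theorem IsDirectLimitOfSubmoduleAffineSchemes.exists_universal_point
    {M : Type u} [AddCommGroup M] [Module R M]
    (h : IsDirectLimitOfSubmoduleAffineSchemes (quasiCoherent R M))
    (S : Type u) [CommRing S] [Algebra R S] (z : S ⊗[R] M) :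
    ∃ (B : Type u) (_ : CommRing B) (_ : Algebra R B) (ξ : B ⊗[R] M) (ν : B →ₐ[R] S),
      LinearMap.rTensor M ν.toLinearMap ξ = z ∧
      ∀ (T : Type u) [CommRing T] [Algebra R T] (α β : B →ₐ[R] T),
        LinearMap.rTensor M α.toLinearMap ξ = LinearMap.rTensor M β.toLinearMap ξ → α = β := by
  obtain ⟨ι, _, _, _, N, t, haff, hmono, ⟨hc⟩⟩ := h
  let X (A : CommAlgCat.{u} R) : (CommAlgCat.{u} R)ᵒᵖᵒᵖ := op (op A)
  obtain ⟨i, n, hn⟩ : ∃ (i : ι) (n : (N.obj i).obj (X (.of R S))),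
      ((t.app i).app (X (.of R S))).hom n = z := by
    have hc' := isColimitOfPreserves
      (PresheafOfModules.evaluation (algebraRing R) (X (.of R S)) ⋙ forget (ModuleCat S)) hc
    obtain ⟨i, n, hn⟩ := Types.jointly_surjective_of_isColimit hc' z
    exact ⟨i, n, hn⟩
  obtain ⟨B, ⟨e⟩⟩ := (isModuleAffineScheme_iff _).mp (haff i)
  have := hmono i
  let τ : yoneda.obj (op B) ⟶ (quasiCoherent R M).presheaf ⋙ forget AddCommGrpCat.{u} :=
    e.hom ≫ Functor.whiskerRight ((PresheafOfModules.toPresheaf _).map (t.app i)) _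
  have hτ (T : CommAlgCat.{u} R) : Function.Injective (τ.app (X T)) := by
    intro a b hab
    have h1 := PresheafOfModules.injective_of_mono (t.app i) (X T) hab
    exact (e.app (X T)).toEquiv.injective h1
  -- Yoneda: `τ` is determined by the image `ξ` of the identity of `B`.
  have hnat (T : CommAlgCat.{u} R) (α : B ⟶ T) : τ.app (X T) α.op =
      LinearMap.rTensor M α.hom.toLinearMap (τ.app (X B) (𝟙 _) : B ⊗[R] M) := by
    have := ConcreteCategory.congr_hom (τ.naturality (X := X B) (Y := X T) α.op.op) (𝟙 (op B))
    refine Eq.trans ?_ this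
    exact congrArg (τ.app (X T)) (Category.comp_id α.op).symm
  refine ⟨B, inferInstance, inferInstance, τ.app (X B) (𝟙 _),
    ((e.app (X (.of R S))).toEquiv.symm n).unop.hom, ?_, ?_⟩
  · rw [← hn]
    refine (hnat (.of R S) ((e.app (X (.of R S))).toEquiv.symm n).unop).symm.trans ?_
    exact congrArg ((t.app i).app (X (.of R S))).hom
      ((e.app (X (.of R S))).toEquiv.apply_symm_apply n)
  · intro T _ _ α β hαβ
    have h1 : (CommAlgCat.ofHom α).op = (CommAlgCat.ofHom β).op :=
      hτ (.of R T) <| (hnat (.of R T) (CommAlgCat.ofHom α)).trans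
        (hαβ.trans (hnat (.of R T) (CommAlgCat.ofHom β)).symm)
    exact congrArg (fun f => f.unop.hom) h1

end Representable


/-! ### Relations tested on square-zero extensions -/

section Dominating

variable {R : Type u} [CommRing R] {M : Type u} [AddCommGroup M] [Module R M]

theorem TensorProduct.exists_eq_sum_fin_tmul {B : Type*} [AddCommGroup B] [Module R B]
    (ξ : B ⊗[R] M) : ∃ (k : ℕ) (b : Fin k → B) (m : Fin k → M), ξ = ∑ s, b s ⊗ₜ[R] m s := by
  induction ξ using TensorProduct.induction_on with
  | zero => exact ⟨0, Fin.elim0, Fin.elim0, by simp⟩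
  | tmul b m => exact ⟨1, fun _ => b, fun _ => m, by simp⟩
  | add x y hx hy =>
    obtain ⟨k, b, m, rfl⟩ := hx
    obtain ⟨l, c, n, rfl⟩ := hy
    exact ⟨k + l, Fin.append b c, Fin.append m n, by simp [Fin.sum_univ_add]⟩

/-- If `𝓜` is a direct limit of submodule affine schemes, then every tuple of elements `m` of `M` is
a combination of another tuple such that all the relations on `m` with coefficients in an
arbitrary module are killed by the coefficients of the combination. -/
theorem IsDirectLimitOfSubmoduleAffineSchemes.exists_dominating
    (h : IsDirectLimitOfSubmoduleAffineSchemes (quasiCoherent R M)) {n : ℕ} (m : Fin n → M) :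
    ∃ (k : ℕ) (m' : Fin k → M) (g : Fin n → Fin k → R),
      (∀ i, ∑ s, g i s • m' s = m i) ∧
      ∀ (C : Type u) [AddCommGroup C] [Module R C] (c : Fin n → C),
        ∑ i, c i ⊗ₜ[R] m i = 0 → ∀ s, ∑ i, g i s • c i = 0 := by
  -- The point `∑ ε_i ⊗ m_i` encodes the whole tuple; the `ε_i`-coordinates of `ν (b s)` are the
  -- coefficients `g i s`.
  obtain ⟨B, _, _, ξ, ν, hz, hinj⟩ := h.exists_universal_point
    (TrivSqZeroExt R (Fin n → R)) (∑ i, TrivSqZeroExt.inr (Pi.single i 1) ⊗ₜ[R] m i)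
  obtain ⟨k, b, m', rfl⟩ := TensorProduct.exists_eq_sum_fin_tmul ξ
  refine ⟨k, m', fun i s => (ν (b s)).snd i, fun i => ?_, fun C _ _ c hc s => ?_⟩
  · have := congrArg (TensorProduct.lid R M ∘ LinearMap.rTensor M
      (LinearMap.proj i ∘ₗ TrivSqZeroExt.sndHom R (Fin n → R))) hz
    simpa [Pi.single_apply, ite_smul] using this
  · let _ : Module Rᵐᵒᵖ C := Module.compHom _ ((RingHom.id R).fromOpposite mul_comm)
    have : IsCentralScalar R C := ⟨fun _ _ => rfl⟩
    -- The maps to `R ⊕ C` with `ε_i ↦ c_i` and `ε_i ↦ 0` both send the point to zero, by the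
    -- relation, so they agree on the image of `B`.
    have key : (TrivSqZeroExt.map (Fintype.linearCombination R c)).comp ν =
        (TrivSqZeroExt.map (0 : (Fin n → R) →ₗ[R] C)).comp ν := by
      apply hinj
      rw [AlgHom.comp_toLinearMap, AlgHom.comp_toLinearMap, LinearMap.rTensor_comp_apply,
        LinearMap.rTensor_comp_apply, hz]
      have := congrArg (LinearMap.rTensor M (TrivSqZeroExt.inrHom R C)) hc
      simpa using this
    have := congrArg TrivSqZeroExt.snd (DFunLike.congr_fun key (b s))
    simpa [Fintype.linearCombination_apply] using this

end Dominating


/-! ### The filtered category of finite free modules over `M` -/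

section Tuples

/-- The category of finite free modules `Rⁿ` over `M`, given by `n`-tuples of elements of `M`. -/
structure FreeOver (R : Type u) [CommRing R] (M : Type u) [AddCommGroup M] [Module R M] where
  /-- the rank -/
  rank : ℕ
  /-- the images of the standard basis -/
  elems : Fin rank → M

namespace FreeOver

variable {R : Type u} [CommRing R] {M : Type u} [AddCommGroup M] [Module R M]

/-- The structure map `Rⁿ → M`. -/
noncomputable def toModule (X : FreeOver R M) : (Fin X.rank → R) →ₗ[R] M :=
  Fintype.linearCombination R X.elems

theorem toModule_single (X : FreeOver R M) (i : Fin X.rank) :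
    X.toModule (Pi.single i 1) = X.elems i := by
  simp [toModule, Fintype.linearCombination_apply_single]

noncomputable instance : Category.{u} (FreeOver R M) where
  Hom X Y := {g : (Fin X.rank → R) →ₗ[R] (Fin Y.rank → R) // Y.toModule ∘ₗ g = X.toModule}
  id X := ⟨LinearMap.id, rfl⟩
  comp f g := ⟨g.1 ∘ₗ f.1, by rw [← LinearMap.comp_assoc, g.2, f.2]⟩

/-- The morphism with given columns. -/
noncomputable def ofColumns {X Y : FreeOver R M} (g : Fin X.rank → Fin Y.rank → R)
    (hg : ∀ i, ∑ s, g i s • Y.elems s = X.elems i) : X ⟶ Y :=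
  ⟨Fintype.linearCombination R g, by
    refine LinearMap.pi_ext' fun i => LinearMap.ext_ring ?_
    simpa [toModule, Fintype.linearCombination_apply_single,
      Fintype.linearCombination_apply] using hg i⟩

theorem ofColumns_apply {X Y : FreeOver R M} (g : Fin X.rank → Fin Y.rank → R)
    (hg : ∀ i, ∑ s, g i s • Y.elems s = X.elems i) (x : Fin X.rank → R) (s : Fin Y.rank) :
    (ofColumns g hg).1 x s = ∑ i, g i s * x i := by
  simp [ofColumns, Fintype.linearCombination_apply, mul_comm]

variable (R M) in
/-- The tautological diagram of free modules. -/
noncomputable def diagram : FreeOver R M ⥤ ModuleCat.{u} R where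
  obj X := ModuleCat.of R (Fin X.rank → R)
  map f := ModuleCat.ofHom f.1

variable (R M) in
/-- The tautological cocone over the diagram of free modules. -/
noncomputable def cocone : Cocone (diagram R M) where
  pt := ModuleCat.of R M
  ι := { app := fun X => ModuleCat.ofHom X.toModule
         naturality := fun {X Y} f => by
          refine ModuleCat.hom_ext ?_
          exact f.2 }

/-- The rank one object at an element. -/
def single (x : M) : FreeOver R M := ⟨1, fun _ => x⟩

theorem toModule_single_one (x : M) : (single (R := R) x).toModule (fun _ => (1 : R)) = x := by
  change (Fintype.linearCombination R (fun _ : Fin 1 => x)) (fun _ => (1 : R)) = x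
  simp [Fintype.linearCombination_apply]

/-- The map out of `M` induced by a cocone. -/
noncomputable def descFun (s : Cocone (diagram R M)) (x : M) : s.pt :=
  (s.ι.app (single x)).hom (fun _ => (1 : R))

/-- The vector `v` is itself a morphism to `X` from the rank one object at its image in `M`.
Compatibility of the cocone with it gives the claim, with no filteredness needed. -/
theorem descFun_toModule (s : Cocone (diagram R M)) (X : FreeOver R M) (v : Fin X.rank → R) :
    descFun s (X.toModule v) = (s.ι.app X).hom v := by
  let f : single (X.toModule v) ⟶ X := ofColumns (fun _ => v) (fun _ => by
    simp [single, toModule, Fintype.linearCombination_apply])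
  have hf : f.1 (fun _ => (1 : R)) = v := by
    ext s
    refine (ofColumns_apply _ _ _ _).trans ?_
    change ∑ _ : Fin 1, v s * 1 = v s
    simp
  have := congrArg (fun φ => φ.hom (fun _ => (1 : R))) (s.w f)
  refine Eq.trans this.symm ?_
  exact congrArg (s.ι.app X).hom hf

variable (R M) in
/-- `M` is the colimit of the free modules over it. -/
noncomputable def isColimitCocone : IsColimit (cocone R M) where
  desc s := ModuleCat.ofHom
    { toFun := descFun s
      map_add' := fun x y => by
        let X : FreeOver R M := ⟨2, ![x, y]⟩
        have h1 : x = X.toModule ![1, 0] := by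
          simp [X, toModule, Fintype.linearCombination_apply]
        have h2 : y = X.toModule ![0, 1] := by
          simp [X, toModule, Fintype.linearCombination_apply]
        rw [h1, h2, ← map_add, descFun_toModule, descFun_toModule, descFun_toModule]
        exact map_add _ _ _
      map_smul' := fun r x => by
        have h1 : x = (single (R := R) x).toModule (fun _ => 1) := (toModule_single_one x).symm
        rw [h1, ← map_smul, descFun_toModule, descFun_toModule]
        exact map_smul _ _ _ }
  fac s X := by
    refine ModuleCat.hom_ext (LinearMap.ext fun v => ?_)
    exact descFun_toModule s X v
  uniq s f hf := by
    refine ModuleCat.hom_ext (LinearMap.ext fun x => ?_)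
    have h1 : x = (single (R := R) x).toModule (fun _ => 1) := (toModule_single_one x).symm
    have := congrArg (fun φ => φ.hom (fun _ => (1 : R))) (hf (single x))
    refine Eq.trans ?_ this
    exact congrArg f.hom h1

/-- A morphism of free modules over `M` which kills every relation that holds in `M`, with
coefficients in an arbitrary module. -/
def IsDominating {X Y : FreeOver R M} (f : X ⟶ Y) : Prop :=
  ∀ (C : Type u) [AddCommGroup C] [Module R C] (c : Fin X.rank → C),
    ∑ i, c i ⊗ₜ[R] X.elems i = 0 → ∀ s, ∑ i, f.1 (Pi.single i 1) s • c i = 0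

theorem exists_isDominating (h : IsDirectLimitOfSubmoduleAffineSchemes (quasiCoherent R M))
    (X : FreeOver R M) : ∃ (Y : FreeOver R M) (f : X ⟶ Y), IsDominating f := by
  obtain ⟨k, m', g, hg, hC⟩ := h.exists_dominating X.elems
  refine ⟨⟨k, m'⟩, ofColumns g hg, fun C _ _ c hc s => ?_⟩
  refine Eq.trans (Finset.sum_congr rfl fun i _ => ?_) (hC C c hc s)
  rw [ofColumns_apply]
  simp [Pi.single_apply]

/-- The case `C = R`, which supplies the equalizing morphisms in `isFiltered`. -/
theorem IsDominating.apply_eq_zero {X Y : FreeOver R M} {f : X ⟶ Y} (hf : IsDominating f)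
    {v : Fin X.rank → R} (hv : X.toModule v = 0) : f.1 v = 0 := by
  ext s
  have := hf R v (by
    refine (TensorProduct.lid R M).injective ?_
    simpa [toModule, Fintype.linearCombination_apply] using hv) s
  conv_lhs => rw [pi_eq_sum_univ' v]
  simpa [mul_comm, Pi.single_apply] using this

theorem range_dualMap_comp_le {X Y Z : FreeOver R M} (f : X ⟶ Y) (g : Y ⟶ Z) :
    LinearMap.range (f ≫ g).1.dualMap ≤ LinearMap.range f.1.dualMap :=
  LinearMap.range_comp_le_range g.1.dualMap f.1.dualMap

/-- The functionals on `X` which factor through a dominating morphism factor through all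
morphisms. -/
theorem IsDominating.range_dualMap_le {X Y Z : FreeOver R M} {f : X ⟶ Y} (hf : IsDominating f)
    (g : X ⟶ Z) : LinearMap.range f.1.dualMap ≤ LinearMap.range g.1.dualMap := by
  have key (s : Fin Y.rank) : LinearMap.proj s ∘ₗ f.1 ∈ LinearMap.range g.1.dualMap := by
    -- These classes are the universal coefficients making the relation hold through `g`: rewriting
    -- `X.elems` in terms of `Z.elems` turns the coefficients into rows of `g`, which vanish in the
    -- quotient.
    let c (i : Fin X.rank) : Module.Dual R (Fin X.rank → R) ⧸ LinearMap.range g.1.dualMap :=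
      Submodule.Quotient.mk (LinearMap.proj i)
    have hsum {W : FreeOver R M} (φ : X ⟶ W) (s : Fin W.rank) :
        ∑ i, φ.1 (Pi.single i 1) s • c i = Submodule.Quotient.mk (LinearMap.proj s ∘ₗ φ.1) := by
      have : (LinearMap.proj s ∘ₗ φ.1 : Module.Dual R (Fin X.rank → R)) =
          ∑ i, φ.1 (Pi.single i 1) s • LinearMap.proj i := by
        refine LinearMap.pi_ext' fun i => LinearMap.ext_ring ?_
        simp [Pi.single_apply]
      rw [this]
      simp [c, ← Submodule.mkQ_apply]
    have h0 := hf _ c ?_ s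
    · rwa [hsum, Submodule.Quotient.mk_eq_zero] at h0
    · have h1 (i) : X.elems i = ∑ s, g.1 (Pi.single i 1) s • Z.elems s := by
        rw [← toModule_single, ← LinearMap.congr_fun g.2]
        simp [toModule, Fintype.linearCombination_apply]
      simp_rw [h1, TensorProduct.tmul_sum, ← TensorProduct.smul_tmul]
      rw [Finset.sum_comm]
      simp_rw [← TensorProduct.sum_tmul, hsum]
      refine Finset.sum_eq_zero fun s _ => ?_
      have h2 : LinearMap.proj s ∘ₗ g.1 ∈ LinearMap.range g.1.dualMap := ⟨LinearMap.proj s, rfl⟩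
      rw [(Submodule.Quotient.mk_eq_zero _).mpr h2, TensorProduct.zero_tmul]
  rintro _ ⟨ψ, rfl⟩
  have : f.1.dualMap ψ = ∑ s, ψ (Pi.single s 1) • (LinearMap.proj s ∘ₗ f.1) := by
    ext i
    simp only [LinearMap.dualMap_apply', LinearMap.comp_apply]
    conv_lhs => rw [pi_eq_sum_univ' (f.1 _)]
    simp [mul_comm]
  rw [this]
  exact Submodule.sum_mem _ fun s _ => Submodule.smul_mem _ _ (key s)

theorem isFiltered (h : IsDirectLimitOfSubmoduleAffineSchemes (quasiCoherent R M)) :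
    IsFiltered (FreeOver R M) where
  nonempty := ⟨⟨0, Fin.elim0⟩⟩
  cocone_objs X Y := by
    refine ⟨⟨X.rank + Y.rank, Fin.append X.elems Y.elems⟩,
      ofColumns (fun i => Pi.single (Fin.castAdd _ i) 1) fun i => ?_,
      ofColumns (fun i => Pi.single (Fin.natAdd _ i) 1) fun i => ?_, trivial⟩
    · simp [Pi.single_apply, ite_smul]
    · simp [Pi.single_apply, ite_smul]
  cocone_maps X Y f g := by
    obtain ⟨Z, p, hp⟩ := exists_isDominating h Y
    refine ⟨Z, p, Subtype.ext (LinearMap.ext fun v => ?_)⟩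
    have := hp.apply_eq_zero (v := f.1 v - g.1 v) (by
      rw [map_sub, ← LinearMap.comp_apply, ← LinearMap.comp_apply, f.2, g.2, sub_self])
    rwa [map_sub, sub_eq_zero] at this

end FreeOver

theorem IsDirectLimitOfSubmoduleAffineSchemes.isFlatMittagLeffler
    {R : Type u} [CommRing R] {M : Type u} [AddCommGroup M] [Module R M]
    (h : IsDirectLimitOfSubmoduleAffineSchemes (quasiCoherent R M)) :
    IsFlatMittagLeffler R M := by
  have := FreeOver.isFiltered h
  obtain ⟨α, _, _, _, F, hF⟩ := IsFiltered.exists_directed (FreeOver R M)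
  obtain ⟨hF1, hF2⟩ := (Functor.final_iff_of_isFiltered F).mp hF
  refine ⟨α, inferInstance, inferInstance, inferInstance, F ⋙ FreeOver.diagram R M,
    Functor.whiskerLeft F (FreeOver.cocone R M).ι, fun i => ?_, ⟨?_⟩, fun i => ?_⟩
  · exact ⟨inferInstanceAs (Module.Free R (Fin _ → R)),
      inferInstanceAs (Module.Finite R (Fin _ → R))⟩
  · exact (Functor.Final.isColimitWhiskerEquiv F _).symm (FreeOver.isColimitCocone R M)
  · obtain ⟨Z, f, hf⟩ := FreeOver.exists_isDominating h (F.obj i)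
    obtain ⟨p, ⟨a⟩⟩ := hF1 Z
    obtain ⟨q, hiq, hpq⟩ := exists_ge_ge i p
    obtain ⟨j, hqj, hj⟩ := hF2 (F.map (homOfLE hiq)) (f ≫ a ≫ F.map (homOfLE hpq))
    have hij : F.map (homOfLE (hiq.trans (leOfHom hqj))) =
        f ≫ (a ≫ F.map (homOfLE hpq)) ≫ F.map hqj := by
      rw [← Category.assoc, ← hj, ← F.map_comp]
      rfl
    refine ⟨j, hiq.trans (leOfHom hqj), fun k hjk => le_antisymm ?_ ?_⟩
    · have : F.map (homOfLE ((hiq.trans (leOfHom hqj)).trans hjk)) =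
          F.map (homOfLE (hiq.trans (leOfHom hqj))) ≫ F.map (homOfLE hjk) := by
        rw [← F.map_comp]
        rfl
      change LinearMap.range (F.map _).1.dualMap ≤ LinearMap.range (F.map _).1.dualMap
      rw [this]
      exact FreeOver.range_dualMap_comp_le _ _
    · refine le_trans ?_ (hf.range_dualMap_le (F.map (homOfLE _)))
      change LinearMap.range (F.map _).1.dualMap ≤ _
      rw [hij]
      exact FreeOver.range_dualMap_comp_le _ _

end Tuples


/-! ### The affine modules `Hom_R(V, -)` and directed unions of submodules -/

section LinearFunctor

variable {R : Type u} [CommRing R]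

/-- The `𝓡`-module `R' ↦ Hom_R(V, R')`. -/
noncomputable def linearFunctor (V : Type u) [AddCommGroup V] [Module R V] : AlgebraModule R where
  obj X := ModuleCat.of X.unop.unop (V →ₗ[R] X.unop.unop)
  map {X Y} f := ModuleCat.ofHom
      (Y := (ModuleCat.restrictScalars ((algebraRing R).map f).hom).obj
        (ModuleCat.of Y.unop.unop (V →ₗ[R] Y.unop.unop)))
    { toFun := fun φ => f.unop.unop.hom.toLinearMap ∘ₗ φ
      map_add' := fun _ _ => LinearMap.comp_add _ _ _
      map_smul' := fun a φ => LinearMap.ext fun v => map_mul f.unop.unop.hom a (φ v) }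
  map_id X := by
    ext φ
    rfl
  map_comp f g := by
    ext φ
    rfl

/-- The functoriality of `linearFunctor`. -/
noncomputable def linearFunctorMap {V W : Type u} [AddCommGroup V] [Module R V] [AddCommGroup W]
    [Module R W] (r : V →ₗ[R] W) : (linearFunctor W : AlgebraModule R) ⟶ linearFunctor V where
  app X := ModuleCat.ofHom
    { toFun := fun (φ : W →ₗ[R] X.unop.unop) => φ ∘ₗ r
      map_add' := fun _ _ => LinearMap.add_comp _ _ _
      map_smul' := fun _ _ => rfl }
  naturality f := by
    ext φ
    rfl

theorem isModuleAffineScheme_linearFunctor (V : Type u) [AddCommGroup V] [Module R V] :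
    IsModuleAffineScheme (linearFunctor V : AlgebraModule R) := by
  refine (isModuleAffineScheme_iff _).mpr ⟨.of R (SymmetricAlgebra R V), ⟨NatIso.ofComponents
    (fun X => Equiv.toIso
      { toFun := fun g => (SymmetricAlgebra.lift.symm g.unop.hom : V →ₗ[R] X.unop.unop)
        invFun := fun (φ : V →ₗ[R] X.unop.unop) => (CommAlgCat.ofHom (SymmetricAlgebra.lift φ)).op
        left_inv := fun g => ?_
        right_inv := fun φ => ?_ }) ?_⟩⟩
  · exact congrArg (fun f => (CommAlgCat.ofHom f).op)
      (SymmetricAlgebra.lift.apply_symm_apply g.unop.hom)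
  · exact SymmetricAlgebra.lift.symm_apply_apply φ
  · intro X Y f
    ext g
    rfl

/-- A directed system of `𝓡`-submodules is a colimit as soon as it is jointly surjective. -/
theorem nonempty_isColimit_of_injective_of_surjective {F : AlgebraModule R} {ι : Type u}
    [Preorder ι] [IsDirectedOrder ι] [Nonempty ι] (N : ι ⥤ AlgebraModule R)
    (t : N ⟶ (Functor.const ι).obj F)
    (hinj : ∀ i X, Function.Injective ((t.app i).app X).hom)
    (hsurj : ∀ X (z : F.obj X), ∃ i n, ((t.app i).app X).hom n = z) :
    Nonempty (IsColimit (Cocone.mk F t)) := by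
  refine ⟨PresheafOfModules.evaluationJointlyReflectsColimits _ _ fun X => ?_⟩
  refine isColimitOfReflects (forget (ModuleCat _)) ?_
  refine Types.FilteredColimit.isColimitOf' _ _ (fun z => ?_) (fun i x y h => ?_)
  · obtain ⟨i, n, hn⟩ := hsurj X z
    exact ⟨i, n, hn.symm⟩
  · obtain rfl := hinj i X h
    exact ⟨i, 𝟙 i, rfl⟩

end LinearFunctor

/-! ### Duality for finite free modules -/

section TensorDual

variable (R : Type u) [CommRing R] (A : Type*) [CommRing A] [Algebra R A]
  {L L' : Type*} [AddCommGroup L] [Module R L] [AddCommGroup L'] [Module R L']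

/-- The evaluation map `A ⊗ L → Hom_R(L*, A)`. -/
noncomputable def tensorToDualHom (L : Type*) [AddCommGroup L] [Module R L] :
    A ⊗[R] L →ₗ[A] (Module.Dual R L →ₗ[R] A) :=
  TensorProduct.AlgebraTensorModule.lift
    { toFun := fun a => LinearMap.flip
        ((LinearMap.toSpanSingleton R A a).compRight R (M := L))
      map_add' := fun a b => by ext; simp
      map_smul' := fun a b => by ext; simp }

variable {R A}

@[simp]
theorem tensorToDualHom_tmul (a : A) (x : L) (ξ : Module.Dual R L) :
    tensorToDualHom R A L (a ⊗ₜ x) ξ = ξ x • a := by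
  simp [tensorToDualHom]

theorem tensorToDualHom_baseChange (g : L →ₗ[R] L') (z : A ⊗[R] L) :
    tensorToDualHom R A L' (g.baseChange A z) = tensorToDualHom R A L z ∘ₗ g.dualMap := by
  induction z using TensorProduct.induction_on with
  | zero => simp
  | tmul a x => ext ξ; simp
  | add x y hx hy => simp only [map_add, hx, hy, LinearMap.add_comp]

theorem tensorToDualHom_rTensor {A' : Type*} [CommRing A'] [Algebra R A'] (f : A →ₐ[R] A')
    (z : A ⊗[R] L) : tensorToDualHom R A' L (LinearMap.rTensor L f.toLinearMap z) =
      f.toLinearMap ∘ₗ tensorToDualHom R A L z := by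
  induction z using TensorProduct.induction_on with
  | zero => simp
  | tmul a x => ext ξ; simp
  | add x y hx hy => simp only [map_add, hx, hy, LinearMap.comp_add]

theorem tensorToDualHom_bijective [Module.Free R L] [Module.Finite R L] :
    Function.Bijective (tensorToDualHom R A L) := by
  let b := Module.Free.chooseBasis R L
  refine Function.bijective_iff_has_inverse.mpr
    ⟨fun φ => ∑ i, φ (b.coord i) ⊗ₜ b i, fun z => ?_, fun φ => ?_⟩
  · induction z using TensorProduct.induction_on with
    | zero => simp
    | tmul a x =>
      simp only [tensorToDualHom_tmul, TensorProduct.smul_tmul, ← TensorProduct.tmul_sum]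
      simp [b.sum_repr]
    | add x y hx hy =>
      simp only [map_add, LinearMap.add_apply, TensorProduct.add_tmul, Finset.sum_add_distrib,
        hx, hy]
  · ext ξ
    conv_rhs => rw [← b.sum_dual_apply_smul_coord ξ]
    simp only [map_sum, map_smul, LinearMap.sum_apply, tensorToDualHom_tmul]

variable (R A L) in
/-- `A ⊗ L ≃ Hom_R(L*, A)` for a finite free module `L`. -/
noncomputable def tensorEquivDualHom [Module.Free R L] [Module.Finite R L] :
    A ⊗[R] L ≃ₗ[A] (Module.Dual R L →ₗ[R] A) :=
  LinearEquiv.ofBijective (tensorToDualHom R A L) tensorToDualHom_bijective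

end TensorDual


/-! ### Stable functionals of a Mittag-Leffler system -/

namespace MittagLefflerSystem

variable {R : Type u} [CommRing R] {ι : Type u} [Preorder ι] (L : ι ⥤ ModuleCat.{u} R)

/-- The functionals on `L i` which extend to every later module of the system. -/
def stableDual (i : ι) : Submodule R (Module.Dual R (L.obj i)) :=
  ⨅ (k : ι) (h : i ≤ k), LinearMap.range (L.map (homOfLE h)).hom.dualMap

variable {L}

theorem mem_stableDual {i : ι} {ξ : Module.Dual R (L.obj i)} : ξ ∈ stableDual L i ↔
    ∀ (k : ι) (h : i ≤ k), ξ ∈ LinearMap.range (L.map (homOfLE h)).hom.dualMap := by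
  simp [stableDual]

theorem dualMap_map_trans {i j k : ι} (hij : i ≤ j) (hjk : j ≤ k)
    (ξ : Module.Dual R (L.obj k)) :
    (L.map (homOfLE hij)).hom.dualMap ((L.map (homOfLE hjk)).hom.dualMap ξ) =
      (L.map (homOfLE (hij.trans hjk))).hom.dualMap ξ := by
  have : L.map (homOfLE (hij.trans hjk)) = L.map (homOfLE hij) ≫ L.map (homOfLE hjk) := by
    rw [← L.map_comp]
    rfl
  rw [this]
  rfl

theorem dualMap_mem_stableDual [IsDirectedOrder ι] {i j : ι} (hij : i ≤ j)
    {ξ : Module.Dual R (L.obj j)} (hξ : ξ ∈ stableDual L j) :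
    (L.map (homOfLE hij)).hom.dualMap ξ ∈ stableDual L i := by
  refine mem_stableDual.mpr fun k hik => ?_
  obtain ⟨l, hjl, hkl⟩ := exists_ge_ge j k
  obtain ⟨η, rfl⟩ := mem_stableDual.mp hξ l hjl
  exact ⟨(L.map (homOfLE hkl)).hom.dualMap η, by rw [dualMap_map_trans, dualMap_map_trans]⟩

/-- Restriction of stable functionals. -/
def restrict [IsDirectedOrder ι] {i j : ι} (hij : i ≤ j) : stableDual L j →ₗ[R] stableDual L i :=
  (L.map (homOfLE hij)).hom.dualMap.restrict fun _ => dualMap_mem_stableDual hij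

variable (L) in
/-- The direct system of the modules `Hom_R(V i, -)`, with `V i` the stable functionals. -/
noncomputable def stableSystem [IsDirectedOrder ι] : ι ⥤ AlgebraModule R where
  obj i := linearFunctor (stableDual L i)
  map f := linearFunctorMap (restrict (leOfHom f))
  map_id i := by
    ext X (φ : stableDual L i →ₗ[R] X.unop.unop)
    refine LinearMap.ext fun v => congrArg φ (Subtype.ext ?_)
    change (L.map (𝟙 i)).hom.dualMap v.1 = v.1
    rw [L.map_id]
    rfl
  map_comp {i j k} f g := by
    ext X (φ : stableDual L i →ₗ[R] X.unop.unop)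
    exact LinearMap.ext fun v => congrArg φ
      (Subtype.ext (dualMap_map_trans (leOfHom f) (leOfHom g) v.1).symm)

variable (L) in
/-- `j ≥ i` is an index at which the images of the duals in `(L i)*` have become constant. -/
def IsStable (i j : ι) : Prop :=
  ∃ h : i ≤ j, LinearMap.range (L.map (homOfLE h)).hom.dualMap ≤ stableDual L i

theorem IsStable.trans {i j k : ι} (h : IsStable L i j) (hjk : j ≤ k) : IsStable L i k := by
  obtain ⟨hij, h⟩ := h
  refine ⟨hij.trans hjk, le_trans ?_ h⟩
  rintro _ ⟨ξ, rfl⟩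
  exact ⟨(L.map (homOfLE hjk)).hom.dualMap ξ, dualMap_map_trans hij hjk ξ⟩

/-- The surjection of `(L j)*` onto the stable functionals on `L i`. -/
def toStableDual {i j : ι} (h : IsStable L i j) :
    Module.Dual R (L.obj j) →ₗ[R] stableDual L i :=
  (L.map (homOfLE h.1)).hom.dualMap.codRestrict _ fun ξ => h.2 ⟨ξ, rfl⟩

theorem toStableDual_surjective {i j : ι} (h : IsStable L i j) :
    Function.Surjective (toStableDual h) := by
  rintro ⟨v, hv⟩
  obtain ⟨ξ, rfl⟩ := mem_stableDual.mp hv j h.1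
  exact ⟨ξ, rfl⟩

theorem toStableDual_dualMap {i j k : ι} (h : IsStable L i j) (hjk : j ≤ k) :
    toStableDual h ∘ₗ (L.map (homOfLE hjk)).hom.dualMap = toStableDual (h.trans hjk) :=
  LinearMap.ext fun ξ => Subtype.ext (dualMap_map_trans h.1 hjk ξ)

theorem restrict_toStableDual [IsDirectedOrder ι] {i i' j : ι} (hi : i ≤ i') (h : IsStable L i j)
    (h' : IsStable L i' j) : restrict hi ∘ₗ toStableDual h' = toStableDual h :=
  LinearMap.ext fun ξ => Subtype.ext (dualMap_map_trans hi h'.1 ξ)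

section BaseChange

variable {M : Type u} [AddCommGroup M] [Module R M]
  (t : L ⟶ (Functor.const ι).obj (ModuleCat.of R M)) {A : Type u} [CommRing A] [Algebra R A]

theorem baseChange_app_map {i j : ι} (hij : i ≤ j) (z : A ⊗[R] L.obj i) :
    (t.app j).hom.baseChange A ((L.map (homOfLE hij)).hom.baseChange A z) =
      (t.app i).hom.baseChange A z := by
  have : L.map (homOfLE hij) ≫ t.app j = t.app i := by
    rw [t.naturality]
    exact Category.comp_id _
  rw [← this, ← LinearMap.comp_apply, ← LinearMap.baseChange_comp]
  rfl

theorem exists_baseChange_eq [IsDirectedOrder ι] [Nonempty ι]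
    (hc : IsColimit (Cocone.mk (ModuleCat.of R M) t)) (z : A ⊗[R] M) :
    ∃ (i : ι) (w : A ⊗[R] L.obj i), (t.app i).hom.baseChange A w = z := by
  have hc' := isColimitOfPreserves
    (MonoidalCategory.tensorLeft (ModuleCat.of R A) ⋙ forget (ModuleCat R)) hc
  obtain ⟨i, w, hw⟩ := Types.jointly_surjective_of_isColimit hc' z
  exact ⟨i, w, hw⟩

theorem exists_baseChange_map_eq_zero [IsDirectedOrder ι] [Nonempty ι]
    (hc : IsColimit (Cocone.mk (ModuleCat.of R M) t)) {i : ι} (w : A ⊗[R] L.obj i)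
    (hw : (t.app i).hom.baseChange A w = 0) :
    ∃ (j : ι) (hij : i ≤ j), (L.map (homOfLE hij)).hom.baseChange A w = 0 := by
  have hc' := isColimitOfPreserves
    (MonoidalCategory.tensorLeft (ModuleCat.of R A) ⋙ forget (ModuleCat R)) hc
  obtain ⟨j, f, hf⟩ := (Types.FilteredColimit.isColimit_eq_iff' hc' w (0 : A ⊗[R] L.obj i)).mp
    (hw.trans (map_zero ((t.app i).hom.baseChange A)).symm)
  exact ⟨j, leOfHom f, hf.trans (map_zero ((L.map f).hom.baseChange A))⟩

end BaseChange

variable [∀ i, Module.Free R (L.obj i)] [∀ i, Module.Finite R (L.obj i)]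
  {M : Type u} [AddCommGroup M] [Module R M] (t : L ⟶ (Functor.const ι).obj (ModuleCat.of R M))
  (A : Type u) [CommRing A] [Algebra R A]

/-- The tensor representing the composite of `φ` with `(L j)* → V i`. -/
noncomputable def lift {i j : ι} (h : IsStable L i j) :
    (stableDual L i →ₗ[R] A) →ₗ[A] A ⊗[R] L.obj j :=
  (tensorEquivDualHom R A (L.obj j)).symm.toLinearMap ∘ₗ
    { toFun := fun φ => φ ∘ₗ toStableDual h
      map_add' := fun _ _ => LinearMap.add_comp _ _ _
      map_smul' := fun _ _ => rfl }

variable {A}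

theorem tensorToDualHom_lift {i j : ι} (h : IsStable L i j) (φ : stableDual L i →ₗ[R] A) :
    tensorToDualHom R A (L.obj j) (lift A h φ) = φ ∘ₗ toStableDual h :=
  (tensorEquivDualHom R A (L.obj j)).apply_symm_apply _

theorem eq_lift {i j : ι} (h : IsStable L i j) {φ : stableDual L i →ₗ[R] A}
    {z : A ⊗[R] L.obj j} (hz : tensorToDualHom R A (L.obj j) z = φ ∘ₗ toStableDual h) :
    z = lift A h φ :=
  tensorToDualHom_bijective.1 (hz.trans (tensorToDualHom_lift h φ).symm)

theorem baseChange_map_lift {i j k : ι} (h : IsStable L i j) (hjk : j ≤ k)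
    (φ : stableDual L i →ₗ[R] A) :
    (L.map (homOfLE hjk)).hom.baseChange A (lift A h φ) = lift A (h.trans hjk) φ := by
  refine eq_lift _ ?_
  rw [tensorToDualHom_baseChange, tensorToDualHom_lift, LinearMap.comp_assoc,
    toStableDual_dualMap]

/-- Both sides agree at a common later index. Hence the arbitrary choice of stable index in
`stableCocone` is harmless. -/
theorem baseChange_app_lift [IsDirectedOrder ι] {i j k : ι} (h : IsStable L i j)
    (h' : IsStable L i k) (φ : stableDual L i →ₗ[R] A) :
    (t.app j).hom.baseChange A (lift A h φ) = (t.app k).hom.baseChange A (lift A h' φ) := by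
  obtain ⟨l, hjl, hkl⟩ := exists_ge_ge j k
  rw [← baseChange_app_map t hjl, ← baseChange_app_map t hkl, baseChange_map_lift,
    baseChange_map_lift]

variable [IsDirectedOrder ι] (hs : ∀ i, ∃ j, IsStable L i j)

/-- The morphisms from the stable system to `𝓜`. -/
noncomputable def stableCocone :
    stableSystem L ⟶ (Functor.const ι).obj (quasiCoherent R M) where
  app i :=
    { app := fun X => ModuleCat.ofHom
        ((t.app (hs i).choose).hom.baseChange X.unop.unop ∘ₗ
          lift X.unop.unop (hs i).choose_spec)
      naturality := fun {X Y} f => by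
        ext (φ : stableDual L i →ₗ[R] X.unop.unop)
        change (t.app (hs i).choose).hom.baseChange Y.unop.unop
            (lift Y.unop.unop (hs i).choose_spec (f.unop.unop.hom.toLinearMap ∘ₗ φ)) =
          LinearMap.rTensor M f.unop.unop.hom.toLinearMap
            ((t.app (hs i).choose).hom.baseChange X.unop.unop
              (lift X.unop.unop (hs i).choose_spec φ))
        rw [← eq_lift (hs i).choose_spec (z := LinearMap.rTensor _ f.unop.unop.hom.toLinearMap
          (lift X.unop.unop (hs i).choose_spec φ))]
        · simp only [LinearMap.baseChange_eq_ltensor]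
          exact LinearMap.congr_fun ((LinearMap.lTensor_comp_rTensor ..).trans
            (LinearMap.rTensor_comp_lTensor ..).symm) _
        · rw [tensorToDualHom_rTensor, tensorToDualHom_lift, LinearMap.comp_assoc] }
  naturality i i' f := by
    ext X (φ : stableDual L i →ₗ[R] X.unop.unop)
    change (t.app (hs i').choose).hom.baseChange X.unop.unop
        (lift X.unop.unop (hs i').choose_spec (φ ∘ₗ restrict (leOfHom f))) =
      (t.app (hs i).choose).hom.baseChange X.unop.unop (lift X.unop.unop (hs i).choose_spec φ)
    obtain ⟨j, h1, h2⟩ := exists_ge_ge (hs i).choose (hs i').choose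
    rw [baseChange_app_lift t _ ((hs i).choose_spec.trans h1),
      baseChange_app_lift t _ ((hs i').choose_spec.trans h2)]
    congr 1
    refine eq_lift _ ?_
    rw [tensorToDualHom_lift, LinearMap.comp_assoc, restrict_toStableDual]

theorem isDirectLimitOfSubmoduleAffineSchemes [Nonempty ι]
    (hc : IsColimit (Cocone.mk (ModuleCat.of R M) t)) (hs : ∀ i, ∃ j, IsStable L i j) :
    IsDirectLimitOfSubmoduleAffineSchemes (quasiCoherent R M) := by
  have hinj (i X) : Function.Injective (((stableCocone t hs).app i).app X).hom := by
    refine (injective_iff_map_eq_zero _).mpr fun (φ : stableDual L i →ₗ[R] X.unop.unop) h0 => ?_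
    -- A tensor vanishing in the limit already vanishes at some `k`, where `(L k)*` still maps onto
    -- the stable functionals, forcing `φ = 0`.
    obtain ⟨k, hk, h1⟩ := exists_baseChange_map_eq_zero t hc _ h0
    rw [baseChange_map_lift] at h1
    have h2 := tensorToDualHom_lift ((hs i).choose_spec.trans hk) φ
    rw [h1, map_zero] at h2
    refine LinearMap.ext fun v => ?_
    obtain ⟨ξ, rfl⟩ := toStableDual_surjective ((hs i).choose_spec.trans hk) v
    exact (LinearMap.congr_fun h2 ξ).symm
  refine ⟨ι, inferInstance, inferInstance, inferInstance, stableSystem L, stableCocone t hs,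
    fun i => isModuleAffineScheme_linearFunctor (stableDual L i),
    fun i => PresheafOfModules.mono_of_injective fun X => hinj i X,
    nonempty_isColimit_of_injective_of_surjective _ _ hinj fun X z => ?_⟩
  obtain ⟨i, w, rfl⟩ := exists_baseChange_eq t hc z
  -- View `w` as a map on `(L i)*` and restrict it to the stable functionals; its lift is the image
  -- of `w` at the chosen stable index.
  refine ⟨i, (tensorToDualHom R X.unop.unop (L.obj i) w ∘ₗ (stableDual L i).subtype :
    stableDual L i →ₗ[R] X.unop.unop), ?_⟩
  refine Eq.trans ?_ (baseChange_app_map t (hs i).choose_spec.1 w)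
  refine congrArg _ (eq_lift _ ?_).symm
  rw [tensorToDualHom_baseChange]
  rfl

end MittagLefflerSystem

theorem IsFlatMittagLeffler.isDirectLimitOfSubmoduleAffineSchemes
    {R : Type u} [CommRing R] {M : Type u} [AddCommGroup M] [Module R M]
    (h : IsFlatMittagLeffler R M) :
    IsDirectLimitOfSubmoduleAffineSchemes (quasiCoherent R M) := by
  obtain ⟨ι, _, _, _, L, t, hL, ⟨hc⟩, hML⟩ := h
  have := fun i => (hL i).1
  have := fun i => (hL i).2
  refine MittagLefflerSystem.isDirectLimitOfSubmoduleAffineSchemes t hc fun i => ?_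
  obtain ⟨j, hij, hj⟩ := hML i
  refine ⟨j, hij, fun ξ hξ => MittagLefflerSystem.mem_stableDual.mpr fun k hik => ?_⟩
  -- The index `k` need not be comparable with `j`: the image from `j` equals that from `l`, which
  -- factors through `k`.
  obtain ⟨l, hjl, hkl⟩ := exists_ge_ge j k
  rw [← hj l hjl] at hξ
  obtain ⟨η, rfl⟩ := hξ
  exact ⟨(L.map (homOfLE hkl)).hom.dualMap η, MittagLefflerSystem.dualMap_map_trans hik hkl η⟩

theorem mainTheorem3 (R : Type u) [CommRing R] (M : Type u) [AddCommGroup M] [Module R M] :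
    IsFlatMittagLeffler R M ↔ IsDirectLimitOfSubmoduleAffineSchemes (quasiCoherent R M) :=
  ⟨fun h => h.isDirectLimitOfSubmoduleAffineSchemes, fun h => h.isFlatMittagLeffler⟩
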